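/- Let $M$ be a smooth manifold (Hausdorff, second countable, without boundary) of dimension $m$. A \emph{local flow} on $M$ is an open set $\Omega\subseteq\mathbb{R}\times M$ that contains $\{0\}\times M$ and meets each $\mathbb{R}\times\{p\}$ in an interval, together with a smooth map $H:\Omega\to M$, $(t,p)\mapsto H_t(p)$, such that $H_0(p)=p$, and $H_{s+t}(p)=H_s(H_t(p))$ whenever both sides are defined. It is \emph{generated} by the vector field $X$ if $X(p)=\frac{d}{dt}\big|_{t=0}H_t(p)$ for all $p\in M$. \textbf{Theorem.} Let $X$ and $Y$ be smooth vector fields on $M$ and let $H$ and $\Gamma$ be local flows generated by $X$ and $Y$, respectively (for instance the maximal ones). Then $[X,Y]=0$ if and only if $$H_t\Gamma_s(p)=\Gamma_sH_t(p)$$ for all $p\in M$ and all $s,t\in\mathbb{R}$ such that both sides are defined and at least one of the two composites $H_{t'}\Gamma_{s'}(p)$, $\Gamma_{s'}H_{t'}(p)$ is defined for all $(s',t')$ in the closed rectangle with opposite corners $(0,0)$ and $(s,t)$. -/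

import Mathlib

open Set
open scoped Manifold ContDiff

/-- A local flow on a smooth manifold `M` of dimension `m`: an open set `domain ⊆ ℝ × M` that
contains `{0} × M` and meets every `ℝ × {p}` in an interval, with a smooth map `domain → M`,
`(t, p) ↦ map t p`, that satisfies `map 0 p = p`, and `map (s + t) p = map s (map t p)` whenever
both sides are defined. The values of `map` outside of `domain` carry no information. -/
structure LocalFlow (m : ℕ) (M : Type*) [TopologicalSpace M]
    [ChartedSpace (EuclideanSpace ℝ (Fin m)) M] where
  domain : Set (ℝ × M)
  map : ℝ → M → M
  isOpen_domain : IsOpen domain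
  zero_mem_domain : ∀ p : M, ((0 : ℝ), p) ∈ domain
  interval_domain : ∀ p : M, {t : ℝ | (t, p) ∈ domain}.OrdConnected
  smooth_map : ContMDiffOn (𝓘(ℝ, ℝ).prod (𝓡 m)) (𝓡 m) ∞ (fun z : ℝ × M => map z.1 z.2) domain
  map_zero : ∀ p : M, map 0 p = p
  map_add : ∀ (s t : ℝ) (p : M), (s + t, p) ∈ domain → (t, p) ∈ domain →
    (s, map t p) ∈ domain → map (s + t) p = map s (map t p)

namespace LocalFlow

variable {m : ℕ} {M : Type*} [TopologicalSpace M] [ChartedSpace (EuclideanSpace ℝ (Fin m)) M]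

/-- `X` is the infinitesimal generator of `H`: for every `p`, the curve `t ↦ H(t, p)` has velocity
`X p` at `t = 0` (recall that `H.map 0 p = p`). -/
def IsGeneratedBy (H : LocalFlow m M) (X : ∀ p : M, TangentSpace (𝓡 m) p) : Prop :=
  ∀ p : M, HasMFDerivAt 𝓘(ℝ, ℝ) (𝓡 m) (fun t : ℝ => H.map t p) 0
    ((1 : ℝ →L[ℝ] ℝ).smulRight (X (H.map 0 p)))

/-- The composite `A_a B_b` is defined at `p`: first `B` for time `b`, then `A` for time `a`. -/
def CompDefinedAt (A B : LocalFlow m M) (a b : ℝ) (p : M) : Prop :=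
  (b, p) ∈ B.domain ∧ (a, B.map b p) ∈ A.domain

/-- The local flows `H` and `Γ` commute: `H_t Γ_s (p) = Γ_s H_t (p)` for all `p`, `s`, `t` such that
both sides are defined and at least one of the two composites is defined at `p` for all pairs of
times `(s', t')` in the closed rectangle with opposite corners `(0, 0)` and `(s, t)`. -/
def Commutes (H Γ : LocalFlow m M) : Prop :=
  ∀ (p : M) (s t : ℝ), H.CompDefinedAt Γ t s p → Γ.CompDefinedAt H s t p →
    ((∀ s' ∈ uIcc 0 s, ∀ t' ∈ uIcc 0 t, H.CompDefinedAt Γ t' s' p) ∨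
      (∀ s' ∈ uIcc 0 s, ∀ t' ∈ uIcc 0 t, Γ.CompDefinedAt H s' t' p)) →
    H.map t (Γ.map s p) = Γ.map s (H.map t p)

end LocalFlow

/-! Suppose `[X, Y] = 0`. Along a trajectory of `X`, both `DH_t (Y p)` and `Y (H_t p)` solve the
linear first variation equation `w' = DX · w`: the former by symmetry of second derivatives, the
latter because `DY · X = DX · Y`. They agree at `t = 0`, hence for small `t`
(`IsFlowNear.eventually_fderiv_apply_eq`, in a chart). The group law and connectedness of the time
domain extend this to all `t` (`LocalFlow.mfderiv_apply_eq`). Thus `H_t` carries integral curves of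
`Y` to integral curves of `Y`, and uniqueness of these curves gives `H_t Γ_s p = Γ_s H_t p`
(`LocalFlow.map_map_comm`).

Conversely, the mixed derivative of `H_t Γ_s p` at `s = t = 0` is `DX · Y` in a chart, and that of
`Γ_s H_t p` is `DY · X`. If the flows commute for small times these coincide, and their difference
is the bracket (`IsFlowNear.lieBracket_eq_zero`). -/

open Filter Topology VectorField

/-! ### Flows near a point of a normed space -/

section NormedSpaceFlow

variable {E : Type*} [NormedAddCommGroup E] [NormedSpace ℝ E]

/-- The second derivative of `f` in the directions `v`, `w` is the derivative in the direction `v`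
of `z ↦ Df(z) w`. -/
theorem fderiv_fderiv_apply_const {F G : Type*} [NormedAddCommGroup F] [NormedSpace ℝ F]
    [NormedAddCommGroup G] [NormedSpace ℝ G] {f : F → G} {z : F}
    (hf : ContDiffAt ℝ 2 f z) (v w : F) :
    fderiv ℝ (fun y => fderiv ℝ f y w) z v = fderiv ℝ (fderiv ℝ f) z v w := by
  have h : DifferentiableAt ℝ (fderiv ℝ f) z :=
    (hf.fderiv_right (m := 1) (by norm_num)).differentiableAt (by norm_num)
  rw [fderiv_clm_apply h (differentiableAt_const w)]
  simp

/-- The derivative of the partial map `y ↦ f (t, y)`. -/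
theorem hasFDerivAt_partial_snd {f : ℝ × E → E} {z : ℝ × E} (hf : DifferentiableAt ℝ f z) :
    HasFDerivAt (fun y => f (z.1, y)) ((fderiv ℝ f z).comp (ContinuousLinearMap.inr ℝ ℝ E)) z.2 :=
  HasFDerivAt.comp (f := fun y => (z.1, y)) z.2 (g := f) hf.hasFDerivAt
    (hasFDerivAt_prodMk_right z.1 z.2)

/-- `f : ℝ × E → E` is, near `(0, x₀)`, a `C²` flow of the vector field `X`. -/
structure IsFlowNear (X : E → E) (f : ℝ × E → E) (x₀ : E) : Prop where
  contDiffAt : ContDiffAt ℝ 2 f (0, x₀)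
  contDiffAt_field : ContDiffAt ℝ 1 X x₀
  zero : ∀ᶠ x in 𝓝 x₀, f (0, x) = x
  fderiv_time : ∀ᶠ z in 𝓝 ((0 : ℝ), x₀), fderiv ℝ f z (1, 0) = X (f z)

namespace IsFlowNear

variable {X Y : E → E} {f g : ℝ × E → E} {x₀ : E}

theorem zero_self (hf : IsFlowNear X f x₀) : f (0, x₀) = x₀ := hf.zero.self_of_nhds

theorem tendsto (hf : IsFlowNear X f x₀) : Tendsto f (𝓝 (0, x₀)) (𝓝 x₀) := by
  have := hf.contDiffAt.continuousAt.tendsto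
  rwa [hf.zero_self] at this

theorem eventually_differentiableAt_field {X : E → E} (h : ContDiffAt ℝ 1 X x₀) :
    ∀ᶠ x in 𝓝 x₀, DifferentiableAt ℝ X x :=
  (h.eventually (by simp)).mono fun _ hx => hx.differentiableAt (by norm_num)

/-- The first variation equation: the mixed second derivative of a flow. -/
theorem fderiv_fderiv_time (hf : IsFlowNear X f x₀) :
    ∀ᶠ z in 𝓝 ((0 : ℝ), x₀), ∀ v : E,
      fderiv ℝ (fderiv ℝ f) z (1, 0) (0, v) = fderiv ℝ X (f z) (fderiv ℝ f z (0, v)) := by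
  filter_upwards [hf.contDiffAt.eventually (by simp), hf.fderiv_time.eventually_nhds,
    hf.tendsto.eventually (eventually_differentiableAt_field hf.contDiffAt_field)] with z h2 ht hX v
  -- Swapping the two directions turns the left side into the space derivative of `∂f/∂t = X ∘ f`.
  rw [h2.isSymmSndFDerivAt (by simp) (1, 0) (0, v), ← fderiv_fderiv_apply_const h2,
    EventuallyEq.fderiv_eq ht]
  have := fderiv_comp z hX (h2.differentiableAt (by norm_num))
  change fderiv ℝ (X ∘ f) z _ = _
  rw [this]; rfl

/-- If `[X, Y] = 0`, then the flow of `X` preserves `Y`. -/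
theorem eventually_fderiv_apply_eq (hf : IsFlowNear X f x₀) (hY : ContDiffAt ℝ 1 Y x₀)
    (hXY : ∀ᶠ x in 𝓝 x₀, lieBracket ℝ X Y x = 0) :
    ∀ᶠ z in 𝓝 ((0 : ℝ), x₀), fderiv ℝ f z (0, Y z.2) = Y (f z) := by
  have hbound : ∀ᶠ z in 𝓝 ((0 : ℝ), x₀), ‖fderiv ℝ X (f z)‖ < ‖fderiv ℝ X x₀‖ + 1 := by
    have hc : ContinuousAt (fun x => ‖fderiv ℝ X x‖) x₀ :=
      ((hf.contDiffAt_field.fderiv_right (m := 0) (by norm_num)).continuousAt).norm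
    exact hf.tendsto.eventually (hc.eventually_lt_const (lt_add_one _))
  have hall := ((((hf.contDiffAt.eventually (by simp)).and hf.fderiv_time).and
    hf.fderiv_fderiv_time).and (hbound.and
      (hf.tendsto.eventually ((eventually_differentiableAt_field hY).and hXY))))
  rw [nhds_prod_eq] at hall
  obtain ⟨P, hP, Q, hQ, hPQ⟩ := eventually_prod_iff.1 hall
  obtain ⟨ε, hε, hball⟩ := Metric.eventually_nhds_iff_ball.1 hP
  rw [nhds_prod_eq]
  filter_upwards [prod_mem_prod (Metric.ball_mem_nhds (0 : ℝ) hε) (hQ.and hf.zero.eventually_nhds)]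
  rintro ⟨t, x⟩ ⟨ht, hx, hx0⟩
  rw [Real.ball_eq_Ioo] at ht hball
  have key : ∀ s ∈ Ioo (0 - ε) (0 + ε), _ := fun s hs => hPQ (hball s hs) hx
  have hline : ∀ s : ℝ, HasDerivAt (fun r : ℝ => (r, x)) ((1 : ℝ), (0 : E)) s := fun s =>
    (hasDerivAt_id s).prodMk (hasDerivAt_const s x)
  -- Continuity of `DX` at `x₀` bounds its norm nearby by `‖DX(x₀)‖ + 1`, which serves as one
  -- Lipschitz constant for all times.
  have hlip : ∀ s ∈ Ioo (0 - ε) (0 + ε), LipschitzOnWith (‖fderiv ℝ X x₀‖₊ + 1)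
      (fun w => fderiv ℝ X (f (s, x)) w) univ := fun s hs =>
    LipschitzOnWith.of_dist_le_mul fun u _ w _ => by
      rw [dist_eq_norm, dist_eq_norm, ← map_sub]
      exact (fderiv ℝ X (f (s, x))).le_of_opNorm_le (key s hs).2.1.le _
  suffices heq : EqOn (fun s => fderiv ℝ f (s, x) (0, Y x)) (fun s => Y (f (s, x)))
    (Ioo (0 - ε) (0 + ε)) from heq ht
  refine ODE_solution_unique_of_mem_Ioo (v := fun s w => fderiv ℝ X (f (s, x)) w)
    (K := ‖fderiv ℝ X x₀‖₊ + 1) (s := fun _ => univ) (t₀ := 0)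
    hlip (by simpa using hε) (fun s hs => ⟨?_, mem_univ _⟩)
    (fun s hs => ⟨?_, mem_univ _⟩) ?_
  · have h2 := (key s hs).1.1.1
    have hd : DifferentiableAt ℝ (fderiv ℝ f) (s, x) :=
      (h2.fderiv_right (m := 1) (by norm_num)).differentiableAt (by norm_num)
    have := (HasFDerivAt.comp_hasDerivAt s (f := fun r : ℝ => (r, x)) hd.hasFDerivAt
      (hline s)).clm_apply
      (hasDerivAt_const s ((0 : ℝ), Y x))
    simpa [(key s hs).1.2 (Y x)] using this
  -- The chain rule gives `DY · X` for the derivative of `Y ∘ f`; the vanishing bracket replaces it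
  -- by `DX · Y`.
  · have h2 := (key s hs).1.1.1
    have hYd := (key s hs).2.2.1
    have hb : fderiv ℝ Y (f (s, x)) (X (f (s, x))) - fderiv ℝ X (f (s, x)) (Y (f (s, x))) = 0 :=
      (key s hs).2.2.2
    have := HasFDerivAt.comp_hasDerivAt s (f := fun r : ℝ => f (r, x)) hYd.hasFDerivAt
      (HasFDerivAt.comp_hasDerivAt s (f := fun r : ℝ => (r, x))
        (h2.differentiableAt (by norm_num)).hasFDerivAt (hline s))
    rw [(key s hs).1.1.2] at this
    rw [sub_eq_zero] at hb
    rwa [hb] at this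
  -- Initial values agree because `f (0, ·)` is the identity near `x`.
  · have h2 := (key 0 (by simpa using hε)).1.1.1
    have h3 := hasFDerivAt_partial_snd (h2.differentiableAt (by norm_num))
    have h4 : HasFDerivAt (fun y => f ((0 : ℝ), y)) (ContinuousLinearMap.id ℝ E) x :=
      (hasFDerivAt_id x).congr_of_eventuallyEq hx0
    have h5 := congrArg (fun L : E →L[ℝ] E => L (Y x)) (h3.unique h4)
    simpa [hx0.self_of_nhds] using h5

/-- If the flows of `X` and `Y` commute near `0` at the point `x₀`, then `[X, Y]` vanishes
at `x₀`. -/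
theorem lieBracket_eq_zero (hf : IsFlowNear X f x₀) (hg : IsFlowNear Y g x₀)
    (hcomm : ∀ᶠ z : ℝ × ℝ in 𝓝 0, f (z.2, g (z.1, x₀)) = g (z.1, f (z.2, x₀))) :
    lieBracket ℝ X Y x₀ = 0 := by
  -- Stated for arbitrary fields so as to be used twice, the second time with the two flows
  -- exchanged.
  have aux : ∀ {X Y : E → E} {f g : ℝ × E → E}, IsFlowNear X f x₀ → IsFlowNear Y g x₀ →
      ∃ φ : ℝ × ℝ → E, φ = (fun z => f (z.2, g (z.1, x₀))) ∧ ContDiffAt ℝ 2 φ 0 ∧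
        fderiv ℝ (fderiv ℝ φ) 0 (1, 0) (0, 1) = fderiv ℝ X x₀ (Y x₀) := by
    intro X Y f g hf hg
    have hin : ContDiffAt ℝ 2 (fun z : ℝ × ℝ => (z.1, x₀)) 0 := by fun_prop
    have hg0 : ContDiffAt ℝ 2 (fun z : ℝ × ℝ => g (z.1, x₀)) 0 := hg.contDiffAt.comp (0 : ℝ × ℝ) hin
    have hp0 : ContDiffAt ℝ 2 (fun z : ℝ × ℝ => (z.2, g (z.1, x₀))) 0 :=
      contDiffAt_snd.prodMk hg0
    have hφ : ContDiffAt ℝ 2 (fun z : ℝ × ℝ => f (z.2, g (z.1, x₀))) 0 := by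
      refine ContDiffAt.comp (g := f) (0 : ℝ × ℝ) ?_ hp0
      simpa [hg.zero_self] using hf.contDiffAt
    refine ⟨_, rfl, hφ, ?_⟩
    have hcurve : ContDiffAt ℝ 2 (fun s : ℝ => g (s, x₀)) 0 := by
      have : ContDiffAt ℝ 2 (fun s : ℝ => (s, x₀)) 0 := by fun_prop
      exact hg.contDiffAt.comp (0 : ℝ) this
    have ht : Tendsto (fun s : ℝ => ((0 : ℝ), g (s, x₀))) (𝓝 0) (𝓝 (0, x₀)) := by
      have := hcurve.continuousAt.tendsto
      rw [hg.zero_self] at this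
      rw [nhds_prod_eq]
      exact tendsto_const_nhds.prodMk this
    have hline : ContinuousAt (fun s : ℝ => (s, (0 : ℝ))) 0 := by fun_prop
    -- At `t = 0` the `t`-derivative is the generator `X` at `g (s, x₀)`; differentiating this in
    -- `s` yields `DX · Y`.
    have hpart : (fun s : ℝ => fderiv ℝ (fun z : ℝ × ℝ => f (z.2, g (z.1, x₀))) (s, 0) (0, 1))
        =ᶠ[𝓝 0] fun s => X (g (s, x₀)) := by
      filter_upwards [hline.tendsto.eventually (hφ.eventually (by simp)),
        ht.eventually hf.fderiv_time, ht.eventually (hf.contDiffAt.eventually (by simp)),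
        (hcurve.continuousAt.tendsto).eventually (hg.zero_self.symm ▸ hf.zero)] with s h1 h2 h3 h4
      have hd1 : HasDerivAt (fun t : ℝ => (s, t)) ((0 : ℝ), (1 : ℝ)) 0 :=
        (hasDerivAt_const _ s).prodMk (hasDerivAt_id _)
      have h5 := (h1.differentiableAt (by norm_num)).hasFDerivAt.comp_hasDerivAt (0 : ℝ) hd1
      have hd2 : HasDerivAt (fun t : ℝ => (t, g (s, x₀))) ((1 : ℝ), (0 : E)) 0 :=
        (hasDerivAt_id _).prodMk (hasDerivAt_const _ _)
      have h6 := (h3.differentiableAt (by norm_num)).hasFDerivAt.comp_hasDerivAt (0 : ℝ) hd2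
      rw [h2, h4] at h6
      exact h5.unique h6
    have hd : DifferentiableAt ℝ (fderiv ℝ (fun z : ℝ × ℝ => f (z.2, g (z.1, x₀)))) 0 :=
      (hφ.fderiv_right (m := 1) (by norm_num)).differentiableAt (by norm_num)
    have hd1 : HasDerivAt (fun s : ℝ => (s, (0 : ℝ))) ((1 : ℝ), (0 : ℝ)) 0 :=
      (hasDerivAt_id _).prodMk (hasDerivAt_const _ _)
    have h7 := (HasFDerivAt.comp_hasDerivAt (0 : ℝ) (f := fun s : ℝ => (s, (0 : ℝ)))
      hd.hasFDerivAt hd1).clm_apply (hasDerivAt_const (0 : ℝ) ((0 : ℝ), (1 : ℝ)))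
    have hd2 : HasDerivAt (fun t : ℝ => (t, x₀)) ((1 : ℝ), (0 : E)) 0 :=
      (hasDerivAt_id _).prodMk (hasDerivAt_const _ _)
    have h8 := HasFDerivAt.comp_hasDerivAt (0 : ℝ) (f := fun t : ℝ => (t, x₀))
      (hg.contDiffAt.differentiableAt (by norm_num)).hasFDerivAt hd2
    rw [hg.fderiv_time.self_of_nhds, hg.zero_self] at h8
    have hXd : HasFDerivAt X (fderiv ℝ X x₀) (g (0, x₀)) := by
      rw [hg.zero_self]
      exact (hf.contDiffAt_field.differentiableAt (by norm_num)).hasFDerivAt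
    have h9 := HasFDerivAt.comp_hasDerivAt (0 : ℝ) (f := fun t : ℝ => g (t, x₀)) hXd h8
    have := h7.unique (h9.congr_of_eventuallyEq hpart)
    simpa using this
  obtain ⟨φ, hφ, hφ2, hφd⟩ := aux hf hg
  obtain ⟨ψ, hψ, hψ2, hψd⟩ := aux hg hf
  have hswap : φ =ᶠ[𝓝 0] fun z => ψ (ContinuousLinearEquiv.prodComm ℝ ℝ ℝ z) := by
    filter_upwards [hcomm] with z hz
    simpa [hφ, hψ] using hz
  have hfd : ∀ᶠ z in 𝓝 (0 : ℝ × ℝ), fderiv ℝ φ z (1, 0) =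
      fderiv ℝ ψ (ContinuousLinearEquiv.prodComm ℝ ℝ ℝ z) (0, 1) := by
    filter_upwards [hswap.eventually_nhds] with z hz
    rw [EventuallyEq.fderiv_eq hz]
    have := (ContinuousLinearEquiv.prodComm ℝ ℝ ℝ).comp_right_fderiv (f := ψ) (x := z)
    change fderiv ℝ (ψ ∘ (ContinuousLinearEquiv.prodComm ℝ ℝ ℝ)) z _ = _
    rw [this]; rfl
  -- Commutation says `φ = ψ ∘ swap` near `0`, and the swap exchanges the two basis directions.
  have hsec : fderiv ℝ (fderiv ℝ φ) 0 (0, 1) (1, 0) = fderiv ℝ (fderiv ℝ ψ) 0 (1, 0) (0, 1) := by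
    rw [← fderiv_fderiv_apply_const hφ2, ← fderiv_fderiv_apply_const hψ2,
      EventuallyEq.fderiv_eq hfd]
    have := (ContinuousLinearEquiv.prodComm ℝ ℝ ℝ).comp_right_fderiv
      (f := fun w => fderiv ℝ ψ w (0, 1)) (x := 0)
    change fderiv ℝ ((fun w => fderiv ℝ ψ w (0, 1)) ∘ (ContinuousLinearEquiv.prodComm ℝ ℝ ℝ)) 0 _
      = _
    rw [this]; rfl
  change fderiv ℝ Y x₀ (X x₀) - fderiv ℝ X x₀ (Y x₀) = 0
  rw [← hφd, ← hψd, ← hsec, hφ2.isSymmSndFDerivAt (by simp) (0, 1) (1, 0), sub_self]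

end IsFlowNear

end NormedSpaceFlow

/-! ### Vector fields in coordinates -/

section Charts

theorem natCast_le_infty (n : ℕ) : (n : WithTop ℕ∞) ≤ ∞ := by exact_mod_cast le_top

variable {m : ℕ} {M : Type*} [TopologicalSpace M] [ChartedSpace (EuclideanSpace ℝ (Fin m)) M]

/-- The coordinate expression of a vector field in the chart at `q₀`. -/
noncomputable def chartField (X : ∀ p : M, TangentSpace (𝓡 m) p) (q₀ : M) :
    EuclideanSpace ℝ (Fin m) → EuclideanSpace ℝ (Fin m) :=
  mpullback 𝓘(ℝ, EuclideanSpace ℝ (Fin m)) (𝓡 m) (extChartAt (𝓡 m) q₀).symm X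

/-- The coordinate expression of a local flow in the chart at `q₀`. -/
noncomputable def chartFlow (H : LocalFlow m M) (q₀ : M) :
    ℝ × EuclideanSpace ℝ (Fin m) → EuclideanSpace ℝ (Fin m) :=
  fun z => extChartAt (𝓡 m) q₀ (H.map z.1 ((extChartAt (𝓡 m) q₀).symm z.2))

/-- All tangent spaces unfold to the same model space, so values at equal base points can be
compared there without a dependent rewrite. -/
theorem vectorField_congr (X : ∀ p : M, TangentSpace (𝓡 m) p) {p q : M} (h : p = q) :
    (X p : EuclideanSpace ℝ (Fin m)) = X q :=
  congrArg (fun p => (X p : EuclideanSpace ℝ (Fin m))) h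

variable [IsManifold (𝓡 m) ∞ M]

theorem isManifold_of_infty (n : ℕ) : IsManifold (𝓡 m) n M :=
  IsManifold.of_le (natCast_le_infty n)

theorem contMDiffAt_extChartAt_symm (q₀ : M) {y : EuclideanSpace ℝ (Fin m)}
    (hy : y ∈ (extChartAt (𝓡 m) q₀).target) :
    ContMDiffAt 𝓘(ℝ, EuclideanSpace ℝ (Fin m)) (𝓡 m) ∞ (extChartAt (𝓡 m) q₀).symm y :=
  (contMDiffOn_extChartAt_symm q₀).contMDiffAt ((isOpen_extChartAt_target q₀).mem_nhds hy)

theorem isInvertible_mfderiv_extChartAt_symm (q₀ : M) {y : EuclideanSpace ℝ (Fin m)}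
    (hy : y ∈ (extChartAt (𝓡 m) q₀).target) :
    (mfderiv 𝓘(ℝ, EuclideanSpace ℝ (Fin m)) (𝓡 m) (extChartAt (𝓡 m) q₀).symm y).IsInvertible := by
  have : IsManifold (𝓡 m) 1 M := isManifold_of_infty 1
  have h := isInvertible_mfderivWithin_extChartAt_symm (I := 𝓡 m) hy
  simpa only [modelWithCornersSelf_coe, range_id, mfderivWithin_univ] using h

theorem mfderiv_extChartAt_symm_chartField (X : ∀ p : M, TangentSpace (𝓡 m) p) (q₀ : M)
    {y : EuclideanSpace ℝ (Fin m)} (hy : y ∈ (extChartAt (𝓡 m) q₀).target) :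
    mfderiv 𝓘(ℝ, EuclideanSpace ℝ (Fin m)) (𝓡 m) (extChartAt (𝓡 m) q₀).symm y
      (chartField X q₀ y) = X ((extChartAt (𝓡 m) q₀).symm y) :=
  (isInvertible_mfderiv_extChartAt_symm q₀ hy).self_apply_inverse _

theorem contDiffAt_chartField {X : ∀ p : M, TangentSpace (𝓡 m) p}
    (hX : ContMDiff (𝓡 m) (𝓡 m).tangent ∞ (fun p => (⟨p, X p⟩ : TangentBundle (𝓡 m) M)))
    (q₀ : M) : ContDiffAt ℝ 1 (chartField X q₀) (extChartAt (𝓡 m) q₀ q₀) := by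
  have : IsManifold (𝓡 m) 1 M := isManifold_of_infty 1
  have hy := mem_extChartAt_target (I := 𝓡 m) q₀
  refine contMDiffAt_vectorSpace_iff_contDiffAt.1 ?_
  exact ContMDiffAt.mpullback_vectorField_preimage (n := ∞) ((hX _).of_le (mod_cast natCast_le_infty 1))
    (contMDiffAt_extChartAt_symm q₀ hy) (isInvertible_mfderiv_extChartAt_symm q₀ hy)
    (by exact_mod_cast natCast_le_infty 2)

/-- Pullback by the inverse chart commutes with brackets, and on a vector space the manifold bracket
is the ordinary one. -/
theorem lieBracket_chartField {X Y : ∀ p : M, TangentSpace (𝓡 m) p}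
    (hX : ContMDiff (𝓡 m) (𝓡 m).tangent ∞ (fun p => (⟨p, X p⟩ : TangentBundle (𝓡 m) M)))
    (hY : ContMDiff (𝓡 m) (𝓡 m).tangent ∞ (fun p => (⟨p, Y p⟩ : TangentBundle (𝓡 m) M)))
    (q₀ : M) {y : EuclideanSpace ℝ (Fin m)} (hy : y ∈ (extChartAt (𝓡 m) q₀).target) :
    lieBracket ℝ (chartField X q₀) (chartField Y q₀) y =
      chartField (mlieBracket (𝓡 m) X Y) q₀ y := by
  have : IsManifold (𝓡 m) (minSmoothness ℝ 3) M := by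
    rw [minSmoothness_of_isRCLikeNormedField]; exact isManifold_of_infty 3
  have h := congrFun (mlieBracketWithin_eq_lieBracketWithin (𝕜 := ℝ) (V := chartField X q₀)
    (W := chartField Y q₀) (s := univ)) y
  rw [lieBracketWithin_univ] at h
  refine h.symm.trans ?_
  exact (mpullback_mlieBracket (n := ∞) ((hX _).mdifferentiableAt (by simp))
    ((hY _).mdifferentiableAt (by simp)) (contMDiffAt_extChartAt_symm q₀ hy)
    (by rw [minSmoothness_of_isRCLikeNormedField]; exact_mod_cast natCast_le_infty 2)).symm

end Charts

/-! ### Local flows in coordinates -/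

namespace LocalFlow

variable {m : ℕ} {M : Type*} [TopologicalSpace M] [ChartedSpace (EuclideanSpace ℝ (Fin m)) M]

theorem contMDiffAt (H : LocalFlow m M) {z : ℝ × M} (hz : z ∈ H.domain) :
    ContMDiffAt (𝓘(ℝ, ℝ).prod (𝓡 m)) (𝓡 m) ∞ (fun z : ℝ × M => H.map z.1 z.2) z :=
  H.smooth_map.contMDiffAt (H.isOpen_domain.mem_nhds hz)

theorem contMDiffAt_slice (H : LocalFlow m M) {t : ℝ} {p : M} (hz : (t, p) ∈ H.domain) :
    ContMDiffAt (𝓡 m) (𝓡 m) ∞ (H.map t) p :=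
  (H.contMDiffAt hz).comp (f := fun q : M => (t, q)) p (contMDiffAt_const.prodMk contMDiffAt_id)

theorem tendsto_map (H : LocalFlow m M) {z : ℝ × M} (hz : z ∈ H.domain) :
    Tendsto (fun z : ℝ × M => H.map z.1 z.2) (𝓝 z) (𝓝 (H.map z.1 z.2)) :=
  (H.contMDiffAt hz).continuousAt

theorem eventually_mem_domain (H : LocalFlow m M) {z : ℝ × M} (hz : z ∈ H.domain) :
    ∀ᶠ w in 𝓝 z, w ∈ H.domain := H.isOpen_domain.mem_nhds hz

/-- The trajectories of a local flow are integral curves of its generator. -/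
theorem IsGeneratedBy.hasMFDerivAt {H : LocalFlow m M} {X : ∀ p : M, TangentSpace (𝓡 m) p}
    (hH : H.IsGeneratedBy X) {t : ℝ} {p : M} (ht : (t, p) ∈ H.domain) :
    HasMFDerivAt 𝓘(ℝ, ℝ) (𝓡 m) (fun s : ℝ => H.map s p) t
      ((1 : ℝ →L[ℝ] ℝ).smulRight (X (H.map t p))) := by
  have h0 := hH (H.map t p)
  rw [vectorField_congr X (H.map_zero (H.map t p))] at h0
  have hsub : HasMFDerivAt 𝓘(ℝ, ℝ) 𝓘(ℝ, ℝ) (fun s : ℝ => s - t) t (ContinuousLinearMap.id ℝ ℝ) :=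
    ((hasFDerivAt_id t).sub_const t).hasMFDerivAt
  have h1 : HasMFDerivAt 𝓘(ℝ, ℝ) (𝓡 m) (fun s : ℝ => H.map s (H.map t p)) (t - t)
      ((1 : ℝ →L[ℝ] ℝ).smulRight (X (H.map t p) : EuclideanSpace ℝ (Fin m))) := by
    rw [sub_self]; exact h0
  have h2 := HasMFDerivAt.comp (f := fun s : ℝ => s - t) t h1 hsub
  -- The group law reduces the velocity at time `t` to the velocity at time `0` from the point `H_t
  -- p`.
  have h3 : (fun s : ℝ => H.map s p) =ᶠ[𝓝 t] fun s => H.map (s - t) (H.map t p) := by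
    have c1 : Tendsto (fun s : ℝ => (s - t, H.map t p)) (𝓝 t) (𝓝 (0, H.map t p)) := by
      have : ContinuousAt (fun s : ℝ => (s - t, H.map t p)) t := by fun_prop
      simpa [ContinuousAt] using this
    have c2 : ContinuousAt (fun s : ℝ => (s, p)) t := by fun_prop
    filter_upwards [c1.eventually (H.eventually_mem_domain (H.zero_mem_domain _)),
      c2.tendsto.eventually (H.eventually_mem_domain ht)] with s hs hs'
    have := H.map_add (s - t) t p (by simpa using hs') ht hs
    simpa using this
  exact h2.congr_of_eventuallyEq h3

variable [IsManifold (𝓡 m) ∞ M]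

/-- Near the centre of a chart, the coordinate expression of a local flow is smooth and lifts to
the flow. -/
theorem eventually_chartFlow (H : LocalFlow m M) (q₀ : M) :
    ∀ᶠ z in 𝓝 ((0 : ℝ), extChartAt (𝓡 m) q₀ q₀),
      z.2 ∈ (extChartAt (𝓡 m) q₀).target ∧ (z.1, (extChartAt (𝓡 m) q₀).symm z.2) ∈ H.domain ∧
      chartFlow H q₀ z ∈ (extChartAt (𝓡 m) q₀).target ∧
      (extChartAt (𝓡 m) q₀).symm (chartFlow H q₀ z) = H.map z.1 ((extChartAt (𝓡 m) q₀).symm z.2) ∧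
      ContDiffAt ℝ 2 (chartFlow H q₀) z := by
  have c1 : Tendsto (fun z : ℝ × EuclideanSpace ℝ (Fin m) =>
      (z.1, (extChartAt (𝓡 m) q₀).symm z.2)) (𝓝 (0, extChartAt (𝓡 m) q₀ q₀)) (𝓝 (0, q₀)) := by
    have h := (continuousAt_extChartAt_symm (I := 𝓡 m) q₀).tendsto
    rw [extChartAt_to_inv] at h
    rw [nhds_prod_eq, nhds_prod_eq]
    exact tendsto_fst.prodMk (h.comp tendsto_snd)
  have c2 := (H.tendsto_map (H.zero_mem_domain q₀))
  rw [H.map_zero] at c2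
  filter_upwards [continuous_snd.continuousAt.eventually (extChartAt_target_mem_nhds (I := 𝓡 m) q₀),
    c1.eventually (H.eventually_mem_domain (H.zero_mem_domain q₀)),
    (c2.comp c1).eventually (extChartAt_source_mem_nhds (I := 𝓡 m) q₀)] with z h1 h2 h3
  refine ⟨h1, h2, (extChartAt (𝓡 m) q₀).map_source h3, (extChartAt (𝓡 m) q₀).left_inv h3, ?_⟩
  have d1 : ContMDiffAt 𝓘(ℝ, ℝ × EuclideanSpace ℝ (Fin m)) (𝓡 m) ∞
      (fun z : ℝ × EuclideanSpace ℝ (Fin m) => (extChartAt (𝓡 m) q₀).symm z.2) z :=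
    (contMDiffAt_extChartAt_symm q₀ h1).comp (f := fun z : ℝ × EuclideanSpace ℝ (Fin m) => z.2) z
      contDiffAt_snd.contMDiffAt
  have d2 : ContMDiffAt 𝓘(ℝ, ℝ × EuclideanSpace ℝ (Fin m)) 𝓘(ℝ, ℝ) ∞
      (fun z : ℝ × EuclideanSpace ℝ (Fin m) => z.1) z := contDiffAt_fst.contMDiffAt
  have d3 := (H.contMDiffAt h2).comp (f := fun z : ℝ × EuclideanSpace ℝ (Fin m) =>
      (z.1, (extChartAt (𝓡 m) q₀).symm z.2)) z (d2.prodMk d1)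
  have d4 := (contMDiffAt_extChartAt' (I := 𝓡 m) (n := ∞) (by rwa [← extChartAt_source (𝓡 m)])).comp z d3
  exact d4.contDiffAt.of_le (mod_cast natCast_le_infty 2)

theorem isFlowNear_chartFlow {H : LocalFlow m M} {X : ∀ p : M, TangentSpace (𝓡 m) p}
    (hX : ContMDiff (𝓡 m) (𝓡 m).tangent ∞ (fun p => (⟨p, X p⟩ : TangentBundle (𝓡 m) M)))
    (hH : H.IsGeneratedBy X) (q₀ : M) :
    IsFlowNear (chartField X q₀) (chartFlow H q₀) (extChartAt (𝓡 m) q₀ q₀) := by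
  refine ⟨(H.eventually_chartFlow q₀).self_of_nhds.2.2.2.2, contDiffAt_chartField hX q₀, ?_, ?_⟩
  · filter_upwards [extChartAt_target_mem_nhds (I := 𝓡 m) q₀] with x hx
    simp only [chartFlow, H.map_zero]
    exact (extChartAt (𝓡 m) q₀).right_inv hx
  · filter_upwards [(H.eventually_chartFlow q₀).eventually_nhds] with z hz
    obtain ⟨-, h2, h3, h4, h5⟩ := hz.self_of_nhds
    have hline : HasFDerivAt (fun t : ℝ => (t, z.2))
        (ContinuousLinearMap.inl ℝ ℝ (EuclideanSpace ℝ (Fin m))) z.1 :=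
      hasFDerivAt_prodMk_left z.1 z.2
    have e1 : HasFDerivAt (fun t : ℝ => chartFlow H q₀ (t, z.2)) _ z.1 :=
      HasFDerivAt.comp (f := fun t : ℝ => (t, z.2)) z.1
        (h5.differentiableAt (by norm_num)).hasFDerivAt hline
    have e2 := HasMFDerivAt.comp (f := fun t : ℝ => chartFlow H q₀ (t, z.2)) z.1
      ((contMDiffAt_extChartAt_symm q₀ h3).mdifferentiableAt (by simp)).hasMFDerivAt
      e1.hasMFDerivAt
    have hev : (fun t : ℝ => H.map t ((extChartAt (𝓡 m) q₀).symm z.2)) =ᶠ[𝓝 z.1]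
        (extChartAt (𝓡 m) q₀).symm ∘ fun t : ℝ => chartFlow H q₀ (t, z.2) := by
      have hl : ContinuousAt (fun t : ℝ => (t, z.2)) z.1 := by fun_prop
      filter_upwards [hl.tendsto.eventually hz] with t ht
      exact ht.2.2.2.1.symm
    have e3 := hasMFDerivAt_unique (e2.congr_of_eventuallyEq hev) (hH.hasMFDerivAt h2)
    have e4 := congrArg (fun L : ℝ →L[ℝ] EuclideanSpace ℝ (Fin m) => L 1) e3
    -- The derivative of the inverse chart is injective, so the equation may be checked on `M`,
    -- where it is the velocity of a trajectory.
    refine (isInvertible_mfderiv_extChartAt_symm q₀ h3).injective ?_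
    rw [mfderiv_extChartAt_symm_chartField X q₀ h3]
    refine Eq.trans ?_ (vectorField_congr X h4).symm
    refine Eq.trans (Eq.trans ?_ e4) ?_
    · rfl
    · exact one_smul ℝ _

/-- If `[X, Y] = 0`, then for small times the flow of `X` maps `Y` to itself. -/
theorem eventually_mfderiv_apply_eq {H : LocalFlow m M} {X Y : ∀ p : M, TangentSpace (𝓡 m) p}
    (hX : ContMDiff (𝓡 m) (𝓡 m).tangent ∞ (fun p => (⟨p, X p⟩ : TangentBundle (𝓡 m) M)))
    (hY : ContMDiff (𝓡 m) (𝓡 m).tangent ∞ (fun p => (⟨p, Y p⟩ : TangentBundle (𝓡 m) M)))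
    (hH : H.IsGeneratedBy X) (hXY : ∀ p, mlieBracket (𝓡 m) X Y p = 0) (q₀ : M) :
    ∀ᶠ z in 𝓝 ((0 : ℝ), q₀), mfderiv (𝓡 m) (𝓡 m) (H.map z.1) z.2 (Y z.2) = Y (H.map z.1 z.2) := by
  have hb : ∀ᶠ x in 𝓝 (extChartAt (𝓡 m) q₀ q₀),
      lieBracket ℝ (chartField X q₀) (chartField Y q₀) x = 0 := by
    filter_upwards [extChartAt_target_mem_nhds (I := 𝓡 m) q₀] with x hx
    rw [lieBracket_chartField hX hY q₀ hx, chartField, mpullback_apply, hXY]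
    exact (mfderiv 𝓘(ℝ, EuclideanSpace ℝ (Fin m)) (𝓡 m)
      (extChartAt (𝓡 m) q₀).symm x).inverse.map_zero
  have hA := (isFlowNear_chartFlow hX hH q₀).eventually_fderiv_apply_eq
    (contDiffAt_chartField hY q₀) hb
  have hchart : Tendsto (fun z : ℝ × M => (z.1, extChartAt (𝓡 m) q₀ z.2)) (𝓝 (0, q₀))
      (𝓝 (0, extChartAt (𝓡 m) q₀ q₀)) := by
    rw [nhds_prod_eq, nhds_prod_eq]
    exact tendsto_fst.prodMk ((continuousAt_extChartAt (I := 𝓡 m) q₀).tendsto.comp tendsto_snd)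
  filter_upwards [hchart.eventually (hA.and (H.eventually_chartFlow q₀).eventually_nhds),
    continuous_snd.continuousAt.eventually (extChartAt_source_mem_nhds (I := 𝓡 m) q₀)]
  rintro ⟨t, q⟩ ⟨hz, hev⟩ hq
  obtain ⟨h1, h2, h3, h4, h5⟩ := hev.self_of_nhds
  have hqx : q = (extChartAt (𝓡 m) q₀).symm (extChartAt (𝓡 m) q₀ q) :=
    ((extChartAt (𝓡 m) q₀).left_inv hq).symm
  simp only at hz hev h1 h2 h3 h4 h5 ⊢
  generalize extChartAt (𝓡 m) q₀ q = x at *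
  subst hqx
  have e1 := hasFDerivAt_partial_snd (h5.differentiableAt (by norm_num))
  have e2 := HasMFDerivAt.comp (f := fun y => chartFlow H q₀ (t, y)) x
    ((contMDiffAt_extChartAt_symm q₀ h3).mdifferentiableAt (by simp)).hasMFDerivAt
    e1.hasMFDerivAt
  have e3 := HasMFDerivAt.comp (I' := 𝓡 m) (I'' := 𝓡 m) (g := H.map t) x
    ((H.contMDiffAt_slice h2).mdifferentiableAt (by simp)).hasMFDerivAt
    ((contMDiffAt_extChartAt_symm q₀ h1).mdifferentiableAt (by simp)).hasMFDerivAt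
  -- Differentiating this intertwining relation at `x` in the direction of the coordinate field of
  -- `Y` transports the coordinate identity `hz` to `M`.
  have heq : (H.map t ∘ (extChartAt (𝓡 m) q₀).symm) =ᶠ[𝓝 x]
      (extChartAt (𝓡 m) q₀).symm ∘ fun y => chartFlow H q₀ (t, y) := by
    have hl : ContinuousAt (fun y : EuclideanSpace ℝ (Fin m) => (t, y)) x := by fun_prop
    filter_upwards [hl.tendsto.eventually hev] with y hy
    exact hy.2.2.2.1.symm
  have e4 := congrArg (fun L : EuclideanSpace ℝ (Fin m) →L[ℝ] EuclideanSpace ℝ (Fin m) =>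
    L (chartField Y q₀ x)) (hasMFDerivAt_unique (e2.congr_of_eventuallyEq heq) e3)
  have e5 := mfderiv_extChartAt_symm_chartField Y q₀ h1
  have e6 := mfderiv_extChartAt_symm_chartField Y q₀ h3
  rw [← hz] at e6
  refine Eq.trans (congrArg _ e5.symm) (Eq.trans e4.symm (Eq.trans e6 (vectorField_congr Y h4)))

end LocalFlow

/-! ### From small times to the whole domain -/

namespace LocalFlow

variable {m : ℕ} {M : Type*} [TopologicalSpace M] [ChartedSpace (EuclideanSpace ℝ (Fin m)) M]

/-- Chain rule for `H_{t'} = H_{t'-t} ∘ H_t`, valid near `q`. The sign of `t' - t` is free, so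
invariance propagates forwards and backwards in time. -/
theorem mfderiv_apply_eq_of_add {H : LocalFlow m M} {Y : ∀ p : M, TangentSpace (𝓡 m) p} {q : M}
    {t t' : ℝ} (ht : (t, q) ∈ H.domain) (ht' : (t', q) ∈ H.domain)
    (hd : (t' - t, H.map t q) ∈ H.domain)
    (hloc : mfderiv (𝓡 m) (𝓡 m) (H.map (t' - t)) (H.map t q) (Y (H.map t q)) =
      Y (H.map (t' - t) (H.map t q)))
    (hY : mfderiv (𝓡 m) (𝓡 m) (H.map t) q (Y q) = Y (H.map t q)) :
    mfderiv (𝓡 m) (𝓡 m) (H.map t') q (Y q) = Y (H.map t' q) := by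
  have hslice : ∀ r : ℝ, Tendsto (fun y : M => (r, y)) (𝓝 q) (𝓝 (r, q)) := fun r =>
    (continuous_const.prodMk continuous_id).continuousAt
  have hev : H.map t' =ᶠ[𝓝 q] H.map (t' - t) ∘ H.map t := by
    have hc : Tendsto (fun y => (t' - t, H.map t y)) (𝓝 q) (𝓝 (t' - t, H.map t q)) := by
      rw [nhds_prod_eq]
      exact tendsto_const_nhds.prodMk (H.contMDiffAt_slice ht).continuousAt.tendsto
    filter_upwards [(hslice t).eventually (H.eventually_mem_domain ht),
      (hslice t').eventually (H.eventually_mem_domain ht'),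
      hc.eventually (H.eventually_mem_domain hd)] with y h1 h2 h3
    simpa using H.map_add (t' - t) t y (by simpa using h2) h1 h3
  have e1 := HasMFDerivAt.comp (I' := 𝓡 m) (I'' := 𝓡 m) (g := H.map (t' - t)) q
    ((H.contMDiffAt_slice hd).mdifferentiableAt (by simp)).hasMFDerivAt
    ((H.contMDiffAt_slice ht).mdifferentiableAt (by simp)).hasMFDerivAt
  have e2 := congrArg (fun L : EuclideanSpace ℝ (Fin m) →L[ℝ] EuclideanSpace ℝ (Fin m) => L (Y q))
    (e1.congr_of_eventuallyEq hev).mfderiv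
  exact e2.trans ((congrArg _ hY).trans (hloc.trans (vectorField_congr Y hev.self_of_nhds.symm)))

/-- The composite of two local flows is defined for small times. -/
theorem eventually_compDefinedAt (H Γ : LocalFlow m M) (p : M) :
    ∀ᶠ z : ℝ × ℝ in 𝓝 0, H.CompDefinedAt Γ z.2 z.1 p := by
  have c1 : Tendsto (fun z : ℝ × ℝ => (z.1, p)) (𝓝 0) (𝓝 (0, p)) :=
    (continuous_fst.prodMk continuous_const).continuousAt
  have c2 : Tendsto (fun z : ℝ × ℝ => (z.2, Γ.map z.1 p)) (𝓝 0) (𝓝 (0, p)) := by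
    have h := (Γ.tendsto_map (Γ.zero_mem_domain p)).comp c1
    rw [Γ.map_zero] at h
    rw [nhds_prod_eq (x := (0 : ℝ)) (y := p)]
    exact continuous_snd.continuousAt.tendsto.prodMk h
  filter_upwards [c1.eventually (Γ.eventually_mem_domain (Γ.zero_mem_domain p)),
    c2.eventually (H.eventually_mem_domain (H.zero_mem_domain p))] with z h1 h2
  exact ⟨h1, h2⟩

/-- For small times the domain conditions in `Commutes` hold automatically: a ball for the sup norm
on `ℝ × ℝ` contains, with each point, the closed rectangle it spans with `0`. -/
theorem Commutes.eventually_eq {H Γ : LocalFlow m M} (h : H.Commutes Γ) (p : M) :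
    ∀ᶠ z : ℝ × ℝ in 𝓝 0, H.map z.2 (Γ.map z.1 p) = Γ.map z.1 (H.map z.2 p) := by
  have hswap : Tendsto (Prod.swap : ℝ × ℝ → ℝ × ℝ) (𝓝 0) (𝓝 0) :=
    continuous_swap.tendsto' _ _ rfl
  obtain ⟨ε, hε, hball⟩ := Metric.eventually_nhds_iff_ball.1
    ((eventually_compDefinedAt H Γ p).and (hswap.eventually (eventually_compDefinedAt Γ H p)))
  filter_upwards [Metric.ball_mem_nhds _ hε] with z hz
  refine h p z.1 z.2 (hball z hz).1 (hball z hz).2 (Or.inl fun s hs t ht => ?_)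
  refine (hball (s, t) ?_).1
  rw [mem_ball_zero_iff, Prod.norm_def, max_lt_iff] at hz ⊢
  have habs : ∀ {x y : ℝ}, x ∈ uIcc 0 y → ‖x‖ ≤ ‖y‖ := fun {x y} hx => by
    simpa using abs_sub_left_of_mem_uIcc hx
  exact ⟨(habs hs).trans_lt hz.1, (habs ht).trans_lt hz.2⟩

variable [IsManifold (𝓡 m) ∞ M]

/-- If `[X, Y] = 0`, then the local flow of `X` maps `Y` to itself. -/
theorem mfderiv_apply_eq {H : LocalFlow m M} {X Y : ∀ p : M, TangentSpace (𝓡 m) p}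
    (hX : ContMDiff (𝓡 m) (𝓡 m).tangent ∞ (fun p => (⟨p, X p⟩ : TangentBundle (𝓡 m) M)))
    (hY : ContMDiff (𝓡 m) (𝓡 m).tangent ∞ (fun p => (⟨p, Y p⟩ : TangentBundle (𝓡 m) M)))
    (hH : H.IsGeneratedBy X) (hXY : ∀ p, mlieBracket (𝓡 m) X Y p = 0) {t : ℝ} {q : M}
    (ht : (t, q) ∈ H.domain) :
    mfderiv (𝓡 m) (𝓡 m) (H.map t) q (Y q) = Y (H.map t q) := by
  -- The relation "invariance at `r` implies invariance at `r'`" is transitive and holds both ways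
  -- for nearby times, hence links `0` to `t`.
  refine (H.interval_domain q).isPreconnected.induction₂'
    (fun r r' => mfderiv (𝓡 m) (𝓡 m) (H.map r) q (Y q) = Y (H.map r q) →
      mfderiv (𝓡 m) (𝓡 m) (H.map r') q (Y q) = Y (H.map r' q)) (fun r hr => ?_)
    (fun _ _ _ _ _ _ h h' => h' ∘ h) (H.zero_mem_domain q) ht ?_
  · have hr : (r, q) ∈ H.domain := hr
    have hloc := (eventually_mfderiv_apply_eq hX hY hH hXY (H.map r q)).and
      (H.eventually_mem_domain (H.zero_mem_domain (H.map r q)))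
    have hline : Tendsto (fun r' : ℝ => (r', q)) (𝓝 r) (𝓝 (r, q)) :=
      (continuous_id.prodMk continuous_const).continuousAt
    have c1 : Tendsto (fun r' : ℝ => (r' - r, H.map r q)) (𝓝 r) (𝓝 (0, H.map r q)) := by
      have : ContinuousAt (fun r' : ℝ => (r' - r, H.map r q)) r := by fun_prop
      simpa [ContinuousAt] using this
    -- Going back from `r'` to `r`, the base point `H_{r'} q` moves with `r'`; this is why the local
    -- statement is joint in time and point.
    have c2 : Tendsto (fun r' : ℝ => (r - r', H.map r' q)) (𝓝 r) (𝓝 (0, H.map r q)) := by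
      rw [nhds_prod_eq]
      refine Tendsto.prodMk ?_ ((H.tendsto_map hr).comp hline)
      have : ContinuousAt (fun r' : ℝ => r - r') r := by fun_prop
      simpa [ContinuousAt] using this
    filter_upwards [nhdsWithin_le_nhds (hline.eventually (H.eventually_mem_domain hr)),
      nhdsWithin_le_nhds (c1.eventually hloc), nhdsWithin_le_nhds (c2.eventually hloc)]
      with r' h1 h2 h3
    exact ⟨mfderiv_apply_eq_of_add hr h1 h2.2 h2.1, mfderiv_apply_eq_of_add h1 hr h3.2 h3.1⟩
  · have h0 : H.map 0 = id := funext H.map_zero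
    have e1 := congrArg (fun L : EuclideanSpace ℝ (Fin m) →L[ℝ] EuclideanSpace ℝ (Fin m) => L (Y q))
      ((hasMFDerivAt_id (I := 𝓡 m) q).congr_of_eventuallyEq
        (EventuallyEq.of_eq h0)).mfderiv
    exact e1.trans (vectorField_congr Y (H.map_zero q).symm)

/-- If `[X, Y] = 0`, then `s ↦ H_t Γ_s p` is an integral curve of `Y`. -/
theorem hasMFDerivAt_comp {H Γ : LocalFlow m M} {X Y : ∀ p : M, TangentSpace (𝓡 m) p}
    (hX : ContMDiff (𝓡 m) (𝓡 m).tangent ∞ (fun p => (⟨p, X p⟩ : TangentBundle (𝓡 m) M)))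
    (hY : ContMDiff (𝓡 m) (𝓡 m).tangent ∞ (fun p => (⟨p, Y p⟩ : TangentBundle (𝓡 m) M)))
    (hH : H.IsGeneratedBy X) (hΓ : Γ.IsGeneratedBy Y)
    (hXY : ∀ p, mlieBracket (𝓡 m) X Y p = 0) {s t : ℝ} {p : M} (h : H.CompDefinedAt Γ t s p) :
    HasMFDerivAt 𝓘(ℝ, ℝ) (𝓡 m) (fun s : ℝ => H.map t (Γ.map s p)) s
      ((1 : ℝ →L[ℝ] ℝ).smulRight (Y (H.map t (Γ.map s p)))) := by
  have e1 := HasMFDerivAt.comp (I' := 𝓡 m) (I'' := 𝓡 m) (g := H.map t)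
    (f := fun s : ℝ => Γ.map s p) s
    ((H.contMDiffAt_slice h.2).mdifferentiableAt (by simp)).hasMFDerivAt (hΓ.hasMFDerivAt h.1)
  have e2 := mfderiv_apply_eq hX hY hH hXY h.2
  have e3 : ∀ (L : EuclideanSpace ℝ (Fin m) →L[ℝ] EuclideanSpace ℝ (Fin m))
      (v : EuclideanSpace ℝ (Fin m)),
      L.comp ((1 : ℝ →L[ℝ] ℝ).smulRight v) = (1 : ℝ →L[ℝ] ℝ).smulRight (L v) := fun L v =>
    ContinuousLinearMap.ext fun c => L.map_smul c v
  rw [← e2]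
  exact e1.congr_mfderiv (e3 (mfderiv (𝓡 m) (𝓡 m) (H.map t) (Γ.map s p)) (Y (Γ.map s p)))

/-- If `[X, Y] = 0`, then `H_t Γ_s p = Γ_s H_t p` as soon as `H_t Γ_σ p` is defined for all `σ`
between `0` and `s`. -/
theorem map_map_comm [T2Space M] {H Γ : LocalFlow m M} {X Y : ∀ p : M, TangentSpace (𝓡 m) p}
    (hX : ContMDiff (𝓡 m) (𝓡 m).tangent ∞ (fun p => (⟨p, X p⟩ : TangentBundle (𝓡 m) M)))
    (hY : ContMDiff (𝓡 m) (𝓡 m).tangent ∞ (fun p => (⟨p, Y p⟩ : TangentBundle (𝓡 m) M)))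
    (hH : H.IsGeneratedBy X) (hΓ : Γ.IsGeneratedBy Y)
    (hXY : ∀ p, mlieBracket (𝓡 m) X Y p = 0) {s t : ℝ} {p : M}
    (h : ∀ σ ∈ uIcc 0 s, H.CompDefinedAt Γ t σ p) (h' : (s, H.map t p) ∈ Γ.domain) :
    H.map t (Γ.map s p) = Γ.map s (H.map t p) := by
  have hnhds : ∀ σ ∈ uIcc 0 s, ∀ᶠ r in 𝓝 σ,
      H.CompDefinedAt Γ t r p ∧ (r, H.map t p) ∈ Γ.domain := by
    intro σ hσ
    have hline : ∀ q : M, Tendsto (fun r : ℝ => (r, q)) (𝓝 σ) (𝓝 (σ, q)) := fun q =>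
      (continuous_id.prodMk continuous_const).continuousAt
    have hd : (σ, H.map t p) ∈ Γ.domain :=
      (Γ.interval_domain (H.map t p)).uIcc_subset (Γ.zero_mem_domain _) h' hσ
    have hc : Tendsto (fun r : ℝ => (t, Γ.map r p)) (𝓝 σ) (𝓝 (t, Γ.map σ p)) := by
      rw [nhds_prod_eq]
      exact tendsto_const_nhds.prodMk ((Γ.tendsto_map (h σ hσ).1).comp (hline p))
    filter_upwards [(hline p).eventually (Γ.eventually_mem_domain (h σ hσ).1),
      hc.eventually (H.eventually_mem_domain (h σ hσ).2),
      (hline _).eventually (Γ.eventually_mem_domain hd)] with r h1 h2 h3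
    exact ⟨⟨h1, h2⟩, h3⟩
  -- Uniqueness of integral curves is applied on an open interval, so the closed segment from `0` to
  -- `s` is enlarged at both ends; the domains are open.
  obtain ⟨a, ha, haU⟩ := exists_Ioc_subset_of_mem_nhds
    (hnhds (min 0 s) ⟨le_rfl, min_le_max⟩) (exists_lt _)
  obtain ⟨b, hb, hbU⟩ := exists_Ico_subset_of_mem_nhds
    (hnhds (max 0 s) ⟨min_le_max, le_rfl⟩) (exists_gt _)
  have hall : ∀ r ∈ Ioo a b, H.CompDefinedAt Γ t r p ∧ (r, H.map t p) ∈ Γ.domain := by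
    intro r hr
    rcases le_total r (min 0 s) with h1 | h1
    · exact haU ⟨hr.1, h1⟩
    rcases le_total (max 0 s) r with h2 | h2
    · exact hbU ⟨h2, hr.2⟩
    exact (hnhds r ⟨h1, h2⟩).self_of_nhds
  have hmem : ∀ r ∈ uIcc 0 s, r ∈ Ioo a b := fun r hr => ⟨ha.trans_le hr.1, hr.2.trans_lt hb⟩
  have : IsManifold (𝓡 m) 1 M := isManifold_of_infty 1
  refine isMIntegralCurveOn_Ioo_eqOn_of_contMDiff_boundaryless (I := 𝓡 m) (v := Y)
    (γ := fun r => H.map t (Γ.map r p)) (γ' := fun r => Γ.map r (H.map t p))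
    (hmem 0 left_mem_uIcc) (hY.of_le (mod_cast natCast_le_infty 1))
    (fun r hr => ?_) (fun r hr => ?_) ?_ (hmem s right_mem_uIcc)
  · exact (hasMFDerivAt_comp hX hY hH hΓ hXY (hall r hr).1).hasMFDerivWithinAt
  · exact (hΓ.hasMFDerivAt (hall r hr).2).hasMFDerivWithinAt
  · simp only [Γ.map_zero]

/-- Commutation for small times passes to the chart centred at `p`; there the coordinate bracket
vanishes, and the derivative of the inverse chart carries this back to `M`. -/
theorem Commutes.mlieBracket_eq_zero {H Γ : LocalFlow m M}
    {X Y : ∀ p : M, TangentSpace (𝓡 m) p}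
    (hX : ContMDiff (𝓡 m) (𝓡 m).tangent ∞ (fun p => (⟨p, X p⟩ : TangentBundle (𝓡 m) M)))
    (hY : ContMDiff (𝓡 m) (𝓡 m).tangent ∞ (fun p => (⟨p, Y p⟩ : TangentBundle (𝓡 m) M)))
    (hH : H.IsGeneratedBy X) (hΓ : Γ.IsGeneratedBy Y) (h : H.Commutes Γ) (p : M) :
    mlieBracket (𝓡 m) X Y p = 0 := by
  have hp := mem_extChartAt_target (I := 𝓡 m) p
  have hlift : ∀ K : LocalFlow m M, ∀ᶠ r : ℝ in 𝓝 0,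
      (extChartAt (𝓡 m) p).symm (chartFlow K p (r, extChartAt (𝓡 m) p p)) = K.map r p := by
    intro K
    have hl : Tendsto (fun r : ℝ => (r, extChartAt (𝓡 m) p p)) (𝓝 0)
        (𝓝 (0, extChartAt (𝓡 m) p p)) :=
      (continuous_id.prodMk continuous_const).continuousAt
    filter_upwards [hl.eventually (K.eventually_chartFlow p)] with r hr
    simpa only [extChartAt_to_inv] using hr.2.2.2.1
  have h0 := (isFlowNear_chartFlow hX hH p).lieBracket_eq_zero (isFlowNear_chartFlow hY hΓ p) (by
    have t1 : Tendsto (Prod.fst : ℝ × ℝ → ℝ) (𝓝 0) (𝓝 0) := continuous_fst.tendsto' _ _ rfl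
    have t2 : Tendsto (Prod.snd : ℝ × ℝ → ℝ) (𝓝 0) (𝓝 0) := continuous_snd.tendsto' _ _ rfl
    filter_upwards [h.eventually_eq p, t1.eventually (hlift Γ), t2.eventually (hlift H)]
      with z h1 h2 h3
    conv_lhs => rw [chartFlow, h2]
    conv_rhs => rw [chartFlow, h3]
    exact congrArg _ h1)
  have h1 := mfderiv_extChartAt_symm_chartField (mlieBracket (𝓡 m) X Y) p hp
  rw [← lieBracket_chartField hX hY p hp, h0] at h1
  have h2 := vectorField_congr (mlieBracket (𝓡 m) X Y) (extChartAt_to_inv (I := 𝓡 m) p)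
  exact h2.symm.trans (h1.symm.trans (mfderiv 𝓘(ℝ, EuclideanSpace ℝ (Fin m)) (𝓡 m)
    (extChartAt (𝓡 m) p).symm (extChartAt (𝓡 m) p p)).map_zero)

end LocalFlow

theorem mainTheorem9 (m : ℕ) (M : Type*) [TopologicalSpace M] [T2Space M]
    [SecondCountableTopology M] [ChartedSpace (EuclideanSpace ℝ (Fin m)) M]
    [IsManifold (𝓡 m) ∞ M]
    (X Y : ∀ p : M, TangentSpace (𝓡 m) p)
    (hX : ContMDiff (𝓡 m) (𝓡 m).tangent ∞ (fun p => (⟨p, X p⟩ : TangentBundle (𝓡 m) M)))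
    (hY : ContMDiff (𝓡 m) (𝓡 m).tangent ∞ (fun p => (⟨p, Y p⟩ : TangentBundle (𝓡 m) M)))
    (H Γ : LocalFlow m M) (hH : H.IsGeneratedBy X) (hΓ : Γ.IsGeneratedBy Y) :
    (∀ p : M, VectorField.mlieBracket (𝓡 m) X Y p = 0) ↔ H.Commutes Γ := by
  refine ⟨fun hXY p s t h1 h2 h3 => ?_, fun h => h.mlieBracket_eq_zero hX hY hH hΓ⟩
  have hYX : ∀ p : M, VectorField.mlieBracket (𝓡 m) Y X p = 0 := fun p =>
    VectorField.mlieBracket_swap_apply.trans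
      ((congrArg (fun v : EuclideanSpace ℝ (Fin m) => -v) (hXY p)).trans neg_zero)
  -- The rectangle enters through one side: fixed `t` when `H_t Γ_s` is defined throughout, fixed
  -- `s` when `Γ_s H_t` is. In the second case the roles of the flows are exchanged, using `[Y, X] =
  -- -[X, Y]`.
  rcases h3 with h3 | h3
  · exact LocalFlow.map_map_comm hX hY hH hΓ hXY (fun σ hσ => h3 σ hσ t right_mem_uIcc) h2.2
  · exact (LocalFlow.map_map_comm hY hX hΓ hH hYX
      (fun σ hσ => h3 s right_mem_uIcc σ hσ) h1.2).symm
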